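/- Graphs are undirected, simple, and may be infinite. A monadic lift of a graph $G$ is the structure obtained from $G$ (viewed as a structure with a binary adjacency relation) by adding unary predicates, interpreted by arbitrary vertex sets. A formula is existential if it is built from quantifier-free first-order formulas by conjunction, disjunction and existential quantification. A formula $\varphi(x,y)$ defines a ladder of length $n$ in a structure $M$ if there are elements $a_1,\dots,a_n,b_1,\dots,b_n$ of $M$ such that for all $i,j\in\{1,\dots,n\}$, $M\models\varphi(a_i,b_j)$ if and only if $i<j$. For $r\in\mathbb N$, the Flipper game of radius $r$ on a graph $G$ is played by Flipper and Connector as follows. The current graph is initially $G$. Each round goes as follows. If the current graph has exactly one vertex, then Flipper wins. Otherwise Connector chooses a vertex $v$ of the current graph $H$, and $H$ is replaced by its subgraph $H'$ induced by the vertices at distance at most $r$ from $v$ in $H$. Then Flipper chooses sets $A,B\subseteq V(H')$ (not necessarily disjoint), and the next current graph is obtained from $H'$ by inverting the adjacency of every pair of distinct vertices one of which is in $A$ and the other in $B$. **Lemma 3.2.** Let $\mathscr C$ be a class of graphs and let $\varphi(x,y)$ be an existential formula in the signature of graphs extended by unary predicates, such that for every $k\in\mathbb N$ there are a graph $M_k\in\mathscr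 C$ and a monadic lift $\widehat{M_k}$ of $M_k$ in which $\varphi(x,y)$ defines a ladder of length at least $k$. Then there exists $r\in\mathbb N$ such that for every $\ell\in\mathbb N$ there is a graph $N_\ell\in\mathscr C$ with the following property: in the Flipper game of radius $r$ with initial current graph $N_\ell$, Connector can play at least $\ell$ rounds without losing, whatever Flipper does. -/

import Mathlib

universe u w

namespace FlipperGame

section Logic

/-- The relation symbols of the signature of graphs (one binary symbol `adj`) extended by unary
predicates indexed by `P`. -/
inductive LiftRel (P : Type w) : ℕ → Type w
  | adj : LiftRel P 2
  | pred (p : P) : LiftRel P 1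

/-- The relational signature of graphs extended by unary predicates indexed by `P`. -/
def liftLanguage (P : Type w) : FirstOrder.Language.{0, w} := ⟨fun _ => Empty, LiftRel P⟩

/-- The adjacency symbol. -/
abbrev adjSymb (P : Type w) : (liftLanguage P).Relations 2 := LiftRel.adj

/-- The symbol of the unary predicate `p`. -/
abbrev predSymb {P : Type w} (p : P) : (liftLanguage P).Relations 1 := LiftRel.pred p

/-- The monadic lift of the graph `G` in which the binary symbol is interpreted by the adjacency
of `G` and the unary predicate `p` marks the vertices of `U p`. -/
@[reducible]
def monadicLift {P : Type w} {V : Type u} (G : SimpleGraph V) (U : P → Set V) :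
    (liftLanguage P).Structure V where
  funMap f := f.elim
  RelMap
    | .adj => fun x => G.Adj (x 0) (x 1)
    | .pred p => fun x => x 0 ∈ U p

/-- Existential formulas: those built from quantifier-free formulas by conjunction, disjunction
and existential quantification. In particular every formula `∃ z₁ … z_q, α` with `α`
quantifier-free is existential (no prenex form is demanded). -/
inductive IsExistential {L : FirstOrder.Language.{0, w}} {α : Type} : ∀ {n : ℕ}, L.BoundedFormula α n → Prop
  | of_isQF {n : ℕ} {φ : L.BoundedFormula α n} : φ.IsQF → IsExistential φ
  | inf {n : ℕ} {φ ψ : L.BoundedFormula α n} :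
      IsExistential φ → IsExistential ψ → IsExistential (φ ⊓ ψ)
  | sup {n : ℕ} {φ ψ : L.BoundedFormula α n} :
      IsExistential φ → IsExistential ψ → IsExistential (φ ⊔ ψ)
  | ex {n : ℕ} {φ : L.BoundedFormula α (n + 1)} : IsExistential φ → IsExistential φ.ex

/-- In the monadic lift of `G` by the sets `U p`, the formula `φ(x, y)` (variable `0` is `x`,
variable `1` is `y`) defines a ladder of length `k`: there are vertices `a₁, …, a_k` and
`b₁, …, b_k` such that `φ(a_i, b_j)` holds if and only if `i < j`. -/
def DefinesLadder {P : Type w} (φ : (liftLanguage P).Formula (Fin 2)) {V : Type u}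
    (G : SimpleGraph V) (U : P → Set V) (k : ℕ) : Prop :=
  letI := monadicLift G U
  ∃ a b : Fin k → V, ∀ i j : Fin k, φ.Realize ![a i, b j] ↔ i < j

end Logic

section Game

/-- The set of vertices at distance at most `r` from `v` in `G` (vertices in other components
are at infinite distance). -/
def closedBall {V : Type u} (G : SimpleGraph V) (v : V) (r : ℕ) : Set V :=
  {w | G.edist v w ≤ r}

@[simp]
theorem mem_closedBall {V : Type u} {G : SimpleGraph V} {v w : V} {r : ℕ} :
    w ∈ closedBall G v r ↔ G.edist v w ≤ r := Iff.rfl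

/-- The atomic flip of `G` between `A` and `B` (not necessarily disjoint): the adjacency of two
distinct vertices is inverted precisely when one of them is in `A` and the other one in `B`. -/
def flip {V : Type u} (G : SimpleGraph V) (A B : Set V) : SimpleGraph V where
  Adj u v := u ≠ v ∧ Xor (G.Adj u v) ((u ∈ A ∧ v ∈ B) ∨ (u ∈ B ∧ v ∈ A))
  symm := ⟨fun u v h => ⟨h.1.symm, by
    have h2 := h.2
    rw [G.adj_comm v u, or_comm, and_comm (a := v ∈ B), and_comm (a := v ∈ A)]
    exact h2⟩⟩
  loopless := ⟨fun _ h => h.1 rfl⟩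

/-- In the Flipper game of radius `r` with current graph `G`, Connector can play at least `ℓ`
rounds without losing, whatever Flipper does. Flipper wins as soon as the current graph has a
single vertex, so Connector has not lost as long as it has at least two vertices. In a round,
Connector chooses a vertex `v`, the current graph is restricted to the ball of radius `r` around
`v`, and then Flipper applies an atomic flip to the result, which gives the next current graph. -/
def ConnectorSurvives (r : ℕ) : ℕ → ∀ {V : Type u}, SimpleGraph V → Prop
  | 0, V, _ => Nontrivial V
  | ℓ + 1, V, G => Nontrivial V ∧ ∃ v : V, ∀ A B : Set (closedBall G v r),
      ConnectorSurvives r ℓ (flip (G.induce (closedBall G v r)) A B)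

end Game

end FlipperGame

/-! A true existential formula is certified by a bounded tuple of witnesses, and its truth passes to
every tuple of the same atomic type. A ladder thus yields a `WeakLadder`: for `i < j` a tuple
through `(a i, b j)` whose atomic type, over finitely many colours, occurs at no pair with `j' ≤
i'`. The condition is one-sided because falsity has no witnesses.

Connector keeps such a ladder alive. By Ramsey, types and truncated distances may be assumed
homogeneous. If the `a i` and `b j` with `i ≠ j` were all far apart, the part of one tuple near `a`
and the part near `b` could be replaced independently, giving a tuple of the forbidden type at a
pair with `j < i` (`not_forall_far`). So many base points lie in one ball of bounded radius. A
slightly larger ball keeps the ladder, even after a flip, once the colours record the distance to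
the centre and the flipped sets (`weakLadder_flip_closedBall`). The radius depends only on the tuple
length; only the palette and the required ladder length grow with the rounds. -/

namespace FlipperGame

/-! ### Ramsey and pigeonhole tools -/

section Combinatorics

/-- In a large enough set one finds a subset of prescribed size in which the colour of a pair
depends only on its smaller element. -/
theorem exists_endHomogeneous (κ : Type*) [Finite κ] (m : ℕ) :
    ∃ N : ℕ, ∀ {α : Type} [LinearOrder α] (c : α → α → κ) (s : Finset α), N ≤ s.card →
      ∃ t ⊆ s, t.card = m ∧ ∃ g : α → κ, ∀ i ∈ t, ∀ j ∈ t, i < j → c i j = g i := by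
  classical
  have := Fintype.ofFinite κ
  induction m with
  | zero =>
    refine ⟨1, fun {α} _ c s hs => ⟨∅, by simp, by simp, fun i => c i i, by simp⟩⟩
  | succ m ih =>
    obtain ⟨N, hN⟩ := ih
    -- One element is the minimum; among the others, some colour of pairs with it occurs at least
    -- `N` times.
    refine ⟨Fintype.card κ * N + 1, fun {α} _ c s hs => ?_⟩
    have hne : s.Nonempty := Finset.card_pos.1 (by omega)
    set i₀ := s.min' hne
    have hi₀ : i₀ ∈ s := s.min'_mem hne
    have : Nonempty κ := ⟨c i₀ i₀⟩
    have hcard : (Finset.univ : Finset κ).card * N ≤ (s.erase i₀).card := by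
      rw [Finset.card_erase_of_mem hi₀, Finset.card_univ]; omega
    obtain ⟨k, -, hk⟩ := Finset.exists_le_card_fiber_of_mul_le_card_of_maps_to
      (f := c i₀) (fun _ _ => Finset.mem_univ _) Finset.univ_nonempty hcard
    obtain ⟨t, hts, htm, g, hg⟩ := hN c _ hk
    have hmem : ∀ j ∈ t, (j ≠ i₀ ∧ j ∈ s) ∧ c i₀ j = k := fun j hj => by
      simpa using hts hj
    have hlt : ∀ j ∈ t, i₀ < j := fun j hj =>
      lt_of_le_of_ne (s.min'_le j (hmem j hj).1.2) (hmem j hj).1.1.symm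
    have hnot : i₀ ∉ t := fun h => lt_irrefl _ (hlt _ h)
    refine ⟨insert i₀ t, ?_, by rw [Finset.card_insert_of_notMem hnot, htm],
      fun i => if i = i₀ then k else g i, ?_⟩
    · exact Finset.insert_subset hi₀ fun j hj => (hmem j hj).1.2
    · intro i hi j hj hij
      rcases Finset.mem_insert.1 hi with rfl | hi
      · rcases Finset.mem_insert.1 hj with rfl | hj
        · exact absurd hij (lt_irrefl _)
        · simpa using (hmem j hj).2
      · rcases Finset.mem_insert.1 hj with rfl | hj
        · exact absurd (hlt i hi) hij.asymm
        · simpa [(hmem i hi).1.1] using hg i hi j hj hij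

/-- Ramsey's theorem for pairs. -/
theorem ramsey_pairs (κ : Type*) [Finite κ] (m : ℕ) :
    ∃ N : ℕ, ∀ c : Fin N → Fin N → κ, ∃ f : Fin m → Fin N, StrictMono f ∧
      ∀ i j i' j', i < j → i' < j' → c (f i) (f j) = c (f i') (f j') := by
  classical
  have := Fintype.ofFinite κ
  obtain ⟨N, hN⟩ := exists_endHomogeneous κ (Fintype.card κ * m + 1)
  refine ⟨N, fun c => ?_⟩
  obtain ⟨t, -, htm, g, hg⟩ := hN c Finset.univ (by simp)
  obtain ⟨i₀, -⟩ : t.Nonempty := Finset.card_pos.1 (by omega)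
  have : Nonempty κ := ⟨c i₀ i₀⟩
  obtain ⟨k, -, hk⟩ := Finset.exists_le_card_fiber_of_mul_le_card_of_maps_to
    (f := g) (s := t) (fun _ _ => Finset.mem_univ _) Finset.univ_nonempty
    (n := m) (by rw [Finset.card_univ]; omega)
  obtain ⟨t', ht', hcard⟩ := Finset.exists_subset_card_eq hk
  have hcol : ∀ i j, i < j → c (t'.orderEmbOfFin hcard i) (t'.orderEmbOfFin hcard j) = k := by
    intro i j hij
    have hi := Finset.mem_filter.1 (ht' (t'.orderEmbOfFin_mem hcard i))
    have hj := Finset.mem_filter.1 (ht' (t'.orderEmbOfFin_mem hcard j))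
    rw [hg _ hi.1 _ hj.1 ((t'.orderEmbOfFin hcard).strictMono hij), hi.2]
  exact ⟨t'.orderEmbOfFin hcard, (t'.orderEmbOfFin hcard).strictMono,
    fun i j i' j' h h' => (hcol i j h).trans (hcol i' j' h').symm⟩

/-- Among `|I| + 1` consecutive intervals of length `w`, one contains no value of `f`. -/
theorem exists_gap {I : Type*} [Fintype I] (f : I → ℕ∞) (b w : ℕ) :
    ∃ t ≤ Fintype.card I, ∀ s, f s ≤ (b + t * w : ℕ) ∨ ((b + (t + 1) * w : ℕ) : ℕ∞) < f s := by
  by_contra! h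
  have : Nonempty I := ⟨(h 0 (Nat.zero_le _)).choose⟩
  choose! s hs using h
  obtain ⟨t, ht, t', ht', hne, heq⟩ := Finset.exists_ne_map_eq_of_card_lt_of_maps_to
    (s := Finset.range (Fintype.card I + 1)) (t := Finset.univ) (f := s) (by simp) (by simp)
  wlog hlt : t < t' generalizing t t'
  · exact this t' ht' t ht hne.symm heq.symm (lt_of_le_of_ne (not_lt.1 hlt) hne.symm)
  have h₁ := (hs t (by simpa [Nat.lt_succ_iff] using ht)).2
  have h₂ := (hs t' (by simpa [Nat.lt_succ_iff] using ht')).1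
  rw [← heq] at h₂
  have := Nat.cast_lt.1 (h₂.trans_le h₁)
  have := Nat.mul_le_mul_right w (Nat.succ_le_of_lt hlt)
  simp only [Nat.succ_eq_add_one] at this
  omega

end Combinatorics

/-! ### Atomic types, gluing and weak ladders -/

section Types

variable {V : Type u} {κ : Type*} {I : Type*}

/-- The tuples `T` and `T'` have the same atomic type in the graph `G` coloured by `col`. -/
structure SameType (G : SimpleGraph V) (col : V → κ) (T T' : I → V) : Prop where
  col_eq : ∀ s, col (T s) = col (T' s)
  eq_iff : ∀ s t, T s = T t ↔ T' s = T' t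
  adj_iff : ∀ s t, G.Adj (T s) (T t) ↔ G.Adj (T' s) (T' t)

theorem SameType.comp {J : Type*} {G : SimpleGraph V} {col : V → κ} {T T' : I → V}
    (h : SameType G col T T') (f : J → I) : SameType G col (T ∘ f) (T' ∘ f) :=
  ⟨fun _ => h.col_eq _, fun _ _ => h.eq_iff _ _, fun _ _ => h.adj_iff _ _⟩

theorem SameType.map_col {κ' : Type*} {G : SimpleGraph V} {col : V → κ} {T T' : I → V}
    (h : SameType G col T T') (g : κ → κ') : SameType G (g ∘ col) T T' :=
  ⟨fun s => congrArg g (h.col_eq s), h.eq_iff, h.adj_iff⟩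

theorem ne_and_not_adj_of_one_lt_edist {G : SimpleGraph V} {u v : V} (h : 1 < G.edist u v) :
    u ≠ v ∧ ¬ G.Adj u v := by
  have := mt SimpleGraph.edist_le_one_iff_adj_or_eq.2 (not_le.2 h)
  tauto

/-- Tuples with the same type on each region can be glued when distinct regions are far apart. -/
theorem SameType.glue {R : Type*} {G : SimpleGraph V} {col : V → κ} {T W : I → V} (ρ : I → R)
    (hcol : ∀ s, col (T s) = col (W s))
    (hin : ∀ s t, ρ s = ρ t →
      ((T s = T t ↔ W s = W t) ∧ (G.Adj (T s) (T t) ↔ G.Adj (W s) (W t))))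
    (hout : ∀ s t, ρ s ≠ ρ t → 1 < G.edist (T s) (T t) ∧ 1 < G.edist (W s) (W t)) :
    SameType G col T W := by
  refine ⟨hcol, fun s t => ?_, fun s t => ?_⟩ <;> by_cases h : ρ s = ρ t
  · exact (hin s t h).1
  · have h₁ := ne_and_not_adj_of_one_lt_edist (hout s t h).1
    have h₂ := ne_and_not_adj_of_one_lt_edist (hout s t h).2
    tauto
  · exact (hin s t h).2
  · have h₁ := ne_and_not_adj_of_one_lt_edist (hout s t h).1
    have h₂ := ne_and_not_adj_of_one_lt_edist (hout s t h).2
    tauto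

/-- For each `i < j` the tuple `T i j` extends the pair `(a i, b j)`, and no tuple extending a pair
`(a i', b j')` with `j' ≤ i'` has the type of one of the tuples `T i j`. -/
def WeakLadder (G : SimpleGraph V) (col : V → κ) (x y : I) (n : ℕ) : Prop :=
  ∃ (a b : Fin n → V) (T : Fin n → Fin n → I → V),
    (∀ i j, i < j → T i j x = a i ∧ T i j y = b j) ∧
    ∀ i j i' j', i < j → j' ≤ i' → ∀ T' : I → V, T' x = a i' → T' y = b j' →
      ¬ SameType G col (T i j) T'

theorem WeakLadder.mono {G : SimpleGraph V} {col : V → κ} {x y : I} {n N : ℕ}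
    (h : WeakLadder G col x y N) (hn : n ≤ N) : WeakLadder G col x y n := by
  obtain ⟨a, b, T, hT, hno⟩ := h
  exact ⟨a ∘ Fin.castLE hn, b ∘ Fin.castLE hn,
    fun i j => T (Fin.castLE hn i) (Fin.castLE hn j),
    fun i j hij => hT _ _ hij, fun i j i' j' h h' => hno _ _ _ _ h h'⟩

/-- On at most one vertex, `T 0 1` itself would extend the forbidden pair `(a 0, b 0)`. -/
theorem WeakLadder.nontrivial {G : SimpleGraph V} {col : V → κ} {x y : I} {n : ℕ}
    (h : WeakLadder G col x y n) (hn : 2 ≤ n) : Nontrivial V := by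
  obtain ⟨a, b, T, hT, hno⟩ := h.mono hn
  by_contra hV
  rw [not_nontrivial_iff_subsingleton] at hV
  exact hno 0 1 0 0 (by simp) le_rfl (T 0 1) (Subsingleton.elim _ _) (Subsingleton.elim _ _)
    ⟨fun _ => rfl, fun _ _ => Iff.rfl, fun _ _ => Iff.rfl⟩

end Types

/-! ### Ladders inside a ball and its flips -/

section Local

variable {V : Type u} {κ : Type*} {I : Type*}

theorem one_lt_edist_of_le_of_lt {G : SimpleGraph V} {c u v : V} {ρ : ℕ}
    (hu : G.edist c u ≤ ρ) (hv : ((ρ + 1 : ℕ) : ℕ∞) < G.edist c v) : 1 < G.edist u v := by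
  by_contra! h
  refine absurd (SimpleGraph.edist_triangle.trans (add_le_add hu h)) (not_le.2 ?_)
  exact_mod_cast hv

/-- Adjacency in `G` is determined by adjacency in a flip of `G`, equality and membership in the
flipped sets. -/
theorem adj_iff_of_flip_adj_iff {G : SimpleGraph V} {A B : Set V} {u v u' v' : V}
    (huA : u ∈ A ↔ u' ∈ A) (hvA : v ∈ A ↔ v' ∈ A) (huB : u ∈ B ↔ u' ∈ B) (hvB : v ∈ B ↔ v' ∈ B)
    (heq : u = v ↔ u' = v') (hadj : (flip G A B).Adj u v ↔ (flip G A B).Adj u' v') :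
    G.Adj u v ↔ G.Adj u' v' := by
  by_cases h : u = v
  · have h' := heq.1 h
    subst h h'
    simp
  · have h' := mt heq.2 h
    simp only [flip, ne_eq, h, h', not_false_eq_true, true_and, huA, hvA, huB, hvB] at hadj
    generalize (u' ∈ A ∧ v' ∈ B ∨ u' ∈ B ∧ v' ∈ A) = Q at hadj
    by_cases hQ : Q <;> simpa [Xor, hQ, not_iff_not] using hadj

/-- The colouring of the ball around `c` that refines `col` by the distance to `c` and by
membership in `A` and `B`. -/
def ballCol (G : SimpleGraph V) (col : V → κ) (c : V) (r : ℕ) (A B : Set (closedBall G c r)) :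
    closedBall G c r → κ × (Fin (r + 1) → Prop) × Prop × Prop :=
  fun v => (col v, fun k => G.edist c v ≤ (k : ℕ), v ∈ A, v ∈ B)

/-- A ladder whose base points lie in a ball survives in a slightly larger ball and in all flips of
it. -/
theorem weakLadder_flip_closedBall [Fintype I] {G : SimpleGraph V} {col : V → κ} {x y : I} {n : ℕ}
    {a b : Fin n → V} {T : Fin n → Fin n → I → V}
    (hT : ∀ i j, i < j → T i j x = a i ∧ T i j y = b j)
    (hno : ∀ i j i' j', i < j → j' ≤ i' → ∀ T' : I → V, T' x = a i' → T' y = b j' →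
      ¬ SameType G col (T i j) T')
    {c : V} {d r : ℕ} (hr : d + Fintype.card I ≤ r)
    (ha : ∀ i, G.edist c (a i) ≤ d) (hb : ∀ i, G.edist c (b i) ≤ d)
    (A B : Set (closedBall G c r)) :
    WeakLadder (flip (G.induce (closedBall G c r)) A B) (ballCol G col c r A B) x y n := by
  classical
  -- Each tuple gets a radius between `d` and `d + |I|` with no coordinate at distance exactly one
  -- more, so its inner and outer parts are neither equal nor adjacent anywhere.
  choose t ht hgap using fun i j => exists_gap (fun s => G.edist c (T i j s)) d 1
  have hle : ∀ {k : ℕ} {v : V}, k ≤ r → G.edist c v ≤ k → v ∈ closedBall G c r := fun hk h =>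
    h.trans (by exact_mod_cast hk)
  have hρ : ∀ i j, d + t i j * 1 ≤ r := fun i j => by have := ht i j; omega
  have hd : ∀ i j, ((d : ℕ) : ℕ∞) ≤ ((d + t i j * 1 : ℕ) : ℕ∞) := fun i j => by
    exact_mod_cast Nat.le_add_right _ _
  -- Filler for the outer coordinates, which may leave the ball; its values are discarded when a
  -- tuple is lifted back to `G`.
  let c' : closedBall G c r := ⟨c, by simp⟩
  obtain ⟨S, hS⟩ : ∃ S : Fin n → Fin n → I → closedBall G c r, ∀ i j s
      (h : G.edist c (T i j s) ≤ (d + t i j * 1 : ℕ)), S i j s = ⟨T i j s, hle (hρ i j) h⟩ :=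
    ⟨fun i j s => if h : G.edist c (T i j s) ≤ (d + t i j * 1 : ℕ)
      then ⟨T i j s, hle (hρ i j) h⟩ else c', fun i j s h => dif_pos h⟩
  refine ⟨fun i => ⟨a i, hle (by omega) (ha i)⟩, fun i => ⟨b i, hle (by omega) (hb i)⟩, S,
    fun i j hij => ?_, ?_⟩
  · obtain ⟨hx, hy⟩ := hT i j hij
    constructor
    · rw [hS i j x (by rw [hx]; exact (ha i).trans (hd i j))]
      exact Subtype.ext hx
    · rw [hS i j y (by rw [hy]; exact (hb j).trans (hd i j))]
      exact Subtype.ext hy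
  · intro i j i' j' hij hij' T' hx' hy' hST
    obtain ⟨hx, hy⟩ := hT i j hij
    set ρ := d + t i j * 1 with hρdef
    have hgap' : ∀ s, ¬ G.edist c (T i j s) ≤ ρ → ((ρ + 1 : ℕ) : ℕ∞) < G.edist c (T i j s) := by
      intro s hs
      have := (hgap i j s).resolve_left hs
      rwa [show d + (t i j + 1) * 1 = ρ + 1 by omega] at this
    have hcol : ∀ s, G.edist c (T i j s) ≤ ρ → col (T i j s) = col (T' s) ∧
        G.edist c (T' s) ≤ ρ := by
      intro s hs
      have h := hST.col_eq s
      simp only [hS i j s hs, ballCol, Prod.mk.injEq] at h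
      refine ⟨h.1, ?_⟩
      have h2 := congrFun h.2.1 ⟨ρ, Nat.lt_succ_of_le (hρ i j)⟩
      exact h2.mp hs
    have hA : ∀ s (hs : G.edist c (T i j s) ≤ ρ), ((⟨T i j s, hle (hρ i j) hs⟩ ∈ A ↔ T' s ∈ A) ∧
        (⟨T i j s, hle (hρ i j) hs⟩ ∈ B ↔ T' s ∈ B)) := by
      intro s hs
      have h := hST.col_eq s
      simp only [hS i j s hs, ballCol, Prod.mk.injEq] at h
      exact ⟨iff_of_eq h.2.2.1, iff_of_eq h.2.2.2⟩
    -- Inner coordinates come from `T'`, outer ones from the original tuple. The distance colours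
    -- keep the inner part of `T'` within `ρ`, so the two parts stay separated.
    refine hno i j i' j' hij hij'
      (fun s => if G.edist c (T i j s) ≤ ρ then (T' s : V) else T i j s) ?_ ?_
      (SameType.glue (fun s => G.edist c (T i j s) ≤ ρ) ?_ ?_ ?_)
    · rw [if_pos (by rw [hx]; exact (ha i).trans (hd i j)), hx']
    · rw [if_pos (by rw [hy]; exact (hb j).trans (hd i j)), hy']
    · intro s
      by_cases hs : G.edist c (T i j s) ≤ ρ
      · simpa [hs] using (hcol s hs).1
      · simp [hs]
    · intro s s' hss
      by_cases hs : G.edist c (T i j s) ≤ ρ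
      · have hs' := hss.mp hs
        have heq := hST.eq_iff s s'
        have hadj := hST.adj_iff s s'
        simp only [hS i j s hs, hS i j s' hs'] at heq hadj
        have := adj_iff_of_flip_adj_iff (hA s hs).1 (hA s' hs').1 (hA s hs).2 (hA s' hs').2
          heq hadj
        simp only [if_pos hs, if_pos hs']
        exact ⟨by simpa [Subtype.ext_iff] using heq, by simpa using this⟩
      · have hs' := mt hss.mpr hs
        simp only [if_neg hs, if_neg hs', and_self]
    · intro s s' hss
      by_cases hs : G.edist c (T i j s) ≤ ρ
      · have hs' : ¬ G.edist c (T i j s') ≤ ρ := fun h => hss (by simp [hs, h])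
        simp only [if_pos hs, if_neg hs']
        exact ⟨one_lt_edist_of_le_of_lt hs (hgap' _ hs'),
          one_lt_edist_of_le_of_lt (hcol s hs).2 (hgap' _ hs')⟩
      · have hs' : G.edist c (T i j s') ≤ ρ := by
          by_contra h
          exact hss (by simp [hs, h])
        simp only [if_neg hs, if_pos hs', SimpleGraph.edist_comm (u := T i j s)]
        exact ⟨one_lt_edist_of_le_of_lt hs' (hgap' _ hs),
          one_lt_edist_of_le_of_lt (hcol s' hs').2 (hgap' _ hs)⟩

end Local

/-! ### Base points cannot all be far apart -/

section Far

variable {V : Type u} {κ : Type*} {I : Type*}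

/-- Let `U l` be tuples anchored at the points `p (π l)`, with the same distances to the anchor up
to a bound. If the points `p` are pairwise close or pairwise far, then there is a bounded radius
`e` such that no coordinate of `U l` is at distance exactly `e + 1` from the anchor, and
coordinates beyond that radius are near at most one of the points `p`. -/
theorem exists_separating_radius [Fintype I] {G : SimpleGraph V} {ι Λ : Type*} (p : ι → V)
    (π : Λ → ι) (U : Λ → I → V) {m d E : ℕ} (hm : Fintype.card I = m) (hd : d = 2 * m + 2)
    (hE : E = d + m * (d + 1))
    (hom : ∀ l l' s, ∀ k ≤ E + d + 1, G.edist (p (π l)) (U l s) ≤ (k : ℕ) →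
      G.edist (p (π l')) (U l' s) ≤ (k : ℕ))
    (hp : (∀ α β, G.edist (p α) (p β) ≤ d) ∨ ∀ α β, α ≠ β → d < G.edist (p α) (p β)) (l₀ : Λ) :
    ∃ e ≤ E, (∀ l s, G.edist (p (π l)) (U l s) ≤ e ∨
        ((e + 1 : ℕ) : ℕ∞) < G.edist (p (π l)) (U l s)) ∧
      ∀ l s, ((e + 1 : ℕ) : ℕ∞) < G.edist (p (π l)) (U l s) → ∀ α β,
        G.edist (p α) (U l s) ≤ (e + 1 : ℕ) → G.edist (p β) (U l s) ≤ (e + 1 : ℕ) → α = β := by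
  rcases hp with hp | hp
  -- Close anchors: a gap of width `d + 1` puts each outer coordinate beyond `e + 1` from every
  -- anchor, so uniqueness is vacuous.
  · obtain ⟨t, ht, hgap⟩ := exists_gap (fun s => G.edist (p (π l₀)) (U l₀ s)) d (d + 1)
    rw [hm] at ht
    have htE : d + t * (d + 1) ≤ E := hE ▸ Nat.add_le_add_left (Nat.mul_le_mul_right _ ht) _
    generalize he : d + t * (d + 1) = e at *
    have hgap' : ∀ l s, G.edist (p (π l)) (U l s) ≤ e ∨
        ((e + 1 + d : ℕ) : ℕ∞) < G.edist (p (π l)) (U l s) := by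
      intro l s
      rcases hgap s with h | h
      · exact Or.inl (hom _ _ _ _ (by omega) h)
      · refine Or.inr (lt_of_not_ge fun h' => (not_le.2 h) ?_)
        rw [show d + (t + 1) * (d + 1) = e + 1 + d by rw [← he]; ring]
        exact hom _ _ _ _ (by omega) h'
    refine ⟨e, htE, fun l s => (hgap' l s).imp_right fun h => lt_of_le_of_lt ?_ h, ?_⟩
    · exact_mod_cast Nat.le_add_right _ _
    · intro l s hs α β hα _
      exfalso
      have h := (hgap' l s).resolve_left (not_le.2 (lt_of_le_of_lt
        (by exact_mod_cast Nat.le_succ _) hs))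
      refine absurd (SimpleGraph.edist_triangle.trans (add_le_add (hp (π l) α) hα)) (not_le.2 ?_)
      rw [add_comm]
      exact_mod_cast h
  -- Far anchors: here `e ≤ m`, so `d = 2 * m + 2` is at least `2 * (e + 1)` and no vertex is within
  -- `e + 1` of two anchors.
  · obtain ⟨e, he, hgap⟩ := exists_gap (fun s => G.edist (p (π l₀)) (U l₀ s)) 0 1
    rw [hm] at he
    simp only [zero_add, mul_one] at hgap
    have heE : e ≤ E := by omega
    refine ⟨e, heE, fun l s => ?_, ?_⟩
    · rcases hgap s with h | h
      · exact Or.inl (hom _ _ _ _ (by omega) h)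
      · exact Or.inr (lt_of_not_ge fun h' => (not_le.2 h) (hom _ _ _ _ (by omega) h'))
    · intro l s _ α β hα hβ
      by_contra hne
      rw [SimpleGraph.edist_comm] at hβ
      refine absurd (hp α β hne) (not_lt.2
        ((SimpleGraph.edist_triangle.trans (add_le_add hα hβ)).trans ?_))
      norm_cast
      omega

/-- If every `s` is related to at most one `i`, at most `|I|` many `i` are related to some `s`. -/
theorem card_filter_exists_le [Fintype I] {ι : Type*} [Fintype ι] (R : ι → I → Prop)
    [DecidablePred fun i => ∃ s, R i s] (h : ∀ s i j, R i s → R j s → i = j) :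
    (Finset.univ.filter fun i => ∃ s, R i s).card ≤ Fintype.card I := by
  classical
  have hex : ∀ i : {i // i ∈ Finset.univ.filter fun i => ∃ s, R i s}, ∃ s, R i s := fun i =>
    (Finset.mem_filter.1 i.2).2
  choose s hs using hex
  rw [← Fintype.card_coe]
  exact Fintype.card_le_of_injective s fun i j hij =>
    Subtype.ext (h (s i) i j (hs i) (hij ▸ hs j))

/-- The coordinates split into a region near `p`, a region near `q` and a rest. The first two are
separated by the distance of `p` and `q`, the rest by the gaps beyond `e` and `f`. -/
theorem one_lt_edist_of_region {G : SimpleGraph V} {p q : V} {e f : ℕ} {X Y : I → Prop}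
    {W : I → V} (hpq : ((e + f + 1 : ℕ) : ℕ∞) < G.edist p q)
    (hX : ∀ s, X s → G.edist p (W s) ≤ e) (hY : ∀ s, ¬ X s → Y s → G.edist q (W s) ≤ f)
    (hZ : ∀ s, ¬ X s → ¬ Y s → ((e + 1 : ℕ) : ℕ∞) < G.edist p (W s) ∧
      ((f + 1 : ℕ) : ℕ∞) < G.edist q (W s))
    {s t : I} (hst : ¬ ((X s ↔ X t) ∧ (¬ X s → (Y s ↔ Y t)))) : 1 < G.edist (W s) (W t) := by
  have hXY : ∀ s t, X s → ¬ X t → Y t → 1 < G.edist (W s) (W t) := by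
    intro s t hs ht ht'
    by_contra! h
    have h₁ := hY t ht ht'
    rw [SimpleGraph.edist_comm] at h₁
    refine absurd (SimpleGraph.edist_triangle.trans (add_le_add
      (SimpleGraph.edist_triangle.trans (add_le_add (hX s hs) h)) h₁)) (not_le.2 ?_)
    refine lt_of_eq_of_lt ?_ hpq
    push_cast
    ring
  by_cases hs : X s <;> by_cases ht : X t
  · tauto
  · by_cases ht' : Y t
    · exact hXY s t hs ht ht'
    · exact one_lt_edist_of_le_of_lt (hX s hs) (hZ t ht ht').1
  · rw [SimpleGraph.edist_comm]
    by_cases hs' : Y s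
    · exact hXY t s ht hs hs'
    · exact one_lt_edist_of_le_of_lt (hX t ht) (hZ s hs hs').1
  · by_cases hs' : Y s <;> by_cases ht' : Y t
    · tauto
    · exact one_lt_edist_of_le_of_lt (hY s hs hs') (hZ t ht ht').2
    · rw [SimpleGraph.edist_comm]
      exact one_lt_edist_of_le_of_lt (hY t ht ht') (hZ s hs hs').2
    · tauto

/-- In a homogeneous ladder the points `a i` and `b j` with `i ≠ j` are not all far apart. -/
theorem not_forall_far [Fintype I] {G : SimpleGraph V} {col : V → κ} {x y : I} {n : ℕ}
    {a b : Fin n → V} {T : Fin n → Fin n → I → V}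
    (hT : ∀ i j, i < j → T i j x = a i ∧ T i j y = b j)
    (hno : ∀ i j i' j', i < j → j' ≤ i' → ∀ T' : I → V, T' x = a i' → T' y = b j' →
      ¬ SameType G col (T i j) T')
    {m d E : ℕ} (hm : Fintype.card I = m) (hd : d = 2 * m + 2)
    (hE : E = d + m * (d + 1)) (hn : 2 * m + 4 ≤ n)
    (hST : ∀ i j i' j', i < j → i' < j' → SameType G col (T i j) (T i' j'))
    (homa : ∀ i j i' j', i < j → i' < j' → ∀ s, ∀ k ≤ 2 * E + 2,
      G.edist (a i) (T i j s) ≤ (k : ℕ) → G.edist (a i') (T i' j' s) ≤ (k : ℕ))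
    (homb : ∀ i j i' j', i < j → i' < j' → ∀ s, ∀ k ≤ 2 * E + 2,
      G.edist (b j) (T i j s) ≤ (k : ℕ) → G.edist (b j') (T i' j' s) ≤ (k : ℕ))
    (ha : (∀ i j, G.edist (a i) (a j) ≤ d) ∨ ∀ i j, i ≠ j → d < G.edist (a i) (a j))
    (hb : (∀ i j, G.edist (b i) (b j) ≤ d) ∨ ∀ i j, i ≠ j → d < G.edist (b i) (b j))
    (hfar : ∀ i j, i ≠ j → ((2 * E + 2 : ℕ) : ℕ∞) < G.edist (a i) (b j)) : False := by
  classical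
  have hdE : d ≤ E := hE ▸ Nat.le_add_right _ _
  let z : Fin n := ⟨0, by omega⟩
  let l : Fin n := ⟨n - 1, by omega⟩
  have hzl : z < l := Fin.mk_lt_mk.2 (by omega)
  let Λ := {q : Fin n × Fin n // q.1 < q.2}
  let l₀ : Λ := ⟨(z, l), hzl⟩
  obtain ⟨e, heE, hgap_a, hsep_a⟩ := exists_separating_radius a (fun q : Λ => q.1.1)
    (fun q => T q.1.1 q.1.2) hm hd hE
    (fun q q' s k hk => homa _ _ _ _ q.2 q'.2 s k (by omega)) ha l₀
  obtain ⟨f, hfE, hgap_b, hsep_b⟩ := exists_separating_radius b (fun q : Λ => q.1.2)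
    (fun q => T q.1.1 q.1.2) hm hd hE
    (fun q q' s k hk => homb _ _ _ _ q.2 q'.2 s k (by omega)) hb l₀
  let X : I → Prop := fun s => G.edist (a z) (T z l s) ≤ e
  let Y : I → Prop := fun s => G.edist (b l) (T z l s) ≤ f
  have hXz : ∀ s, ¬ X s → ((e + 1 : ℕ) : ℕ∞) < G.edist (a z) (T z l s) := fun s =>
    (hgap_a l₀ s).resolve_left
  have hYl : ∀ s, ¬ Y s → ((f + 1 : ℕ) : ℕ∞) < G.edist (b l) (T z l s) := fun s =>
    (hgap_b l₀ s).resolve_left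
  let Ra : Fin n → I → Prop := fun i s => ¬ X s ∧ G.edist (a i) (T z l s) ≤ (e + 1 : ℕ)
  let Rb : Fin n → I → Prop := fun i s => ¬ Y s ∧ G.edist (b i) (T z l s) ≤ (f + 1 : ℕ)
  have hRa := card_filter_exists_le Ra fun s i j hi hj =>
    hsep_a l₀ s (hXz s hi.1) i j hi.2 hj.2
  have hRb := card_filter_exists_le Rb fun s i j hi hj =>
    hsep_b l₀ s (hYl s hi.1) i j hi.2 hj.2
  -- An outer coordinate is near at most one `a i` and at most one `b i`, so at most `m + m` indices
  -- are spoiled. With the two endpoints excluded too, `2 * m + 4 ≤ n` leaves two good indices.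
  set bad : Finset (Fin n) := (Finset.univ.filter fun i => ∃ s, Ra i s) ∪
    (Finset.univ.filter fun i => ∃ s, Rb i s) ∪ {z, l} with hbad
  have hcard : bad.card ≤ 2 * m + 2 := by
    refine (Finset.card_union_le _ _).trans ?_
    have h₁ := Finset.card_union_le (Finset.univ.filter fun i => ∃ s, Ra i s)
      (Finset.univ.filter fun i => ∃ s, Rb i s)
    have h₂ : ({z, l} : Finset (Fin n)).card ≤ 2 := Finset.card_le_two
    omega
  have hgood : 1 < (badᶜ).card := by
    rw [Finset.card_compl, Fintype.card_fin]
    omega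
  have hmem : ∀ i ∈ badᶜ, (∀ s, ¬ Ra i s) ∧ (∀ s, ¬ Rb i s) ∧ z < i ∧ i < l := by
    intro i hi
    simp only [hbad, Finset.mem_compl, Finset.mem_union, Finset.mem_filter, Finset.mem_univ,
      true_and, Finset.mem_insert, Finset.mem_singleton, not_or, not_exists] at hi
    refine ⟨hi.1.1, hi.1.2, lt_of_le_of_ne (Fin.mk_le_of_le_val (Nat.zero_le _)) (Ne.symm hi.2.1),
      lt_of_le_of_ne ?_ hi.2.2⟩
    exact Fin.mk_le_mk.2 (by have := i.2; omega)
  obtain ⟨j, hj, i, hi, hji⟩ : ∃ j ∈ badᶜ, ∃ i ∈ badᶜ, j < i := by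
    obtain ⟨i, hi, j, hj, hij⟩ := Finset.one_lt_card.1 hgood
    rcases lt_or_gt_of_ne hij with h | h
    · exact ⟨i, hi, j, hj, h⟩
    · exact ⟨j, hj, i, hi, h⟩
  obtain ⟨hi_a, -, -, hil⟩ := hmem i hi
  obtain ⟨-, hj_b, hzj, -⟩ := hmem j hj
  have hpq : ∀ i j, i ≠ j → ((e + f + 1 : ℕ) : ℕ∞) < G.edist (a i) (b j) := fun i j hij =>
    lt_of_le_of_lt (by norm_cast; omega) (hfar i j hij)
  have hzl_ST := hST z l i l hzl hil
  have hzj_ST := hST z l z j hzl hzj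
  have hx : X x := by simp [X, (hT z l hzl).1]
  have hyY : Y y := by simp [Y, (hT z l hzl).2]
  have hyX : ¬ X y := by
    intro h
    simp only [X, (hT z l hzl).2] at h
    exact absurd (hpq z l hzl.ne) (not_lt.2 (h.trans (by norm_cast; omega)))
  -- Moving the part near `a z` to `a i` and the part near `b l` to `b j` keeps the type region by
  -- region, yet the result extends `(a i, b j)` with `j < i`.
  let W : I → V := fun s => if X s then T i l s else if Y s then T z j s else T z l s
  refine hno z l i j hzl hji.le W (by simp [W, hx, (hT i l hil).1])
    (by simp [W, hyX, hyY, (hT z j hzj).2])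
    (SameType.glue (fun s => (X s, ¬ X s ∧ Y s)) (fun s => ?_) (fun s t hst => ?_)
      fun s t hst => ?_)
  · by_cases hX : X s
    · simpa [W, hX] using hzl_ST.col_eq s
    · by_cases hY : Y s
      · simpa [W, hX, hY] using hzj_ST.col_eq s
      · simp [W, hX, hY]
  · simp only [Prod.mk.injEq, eq_iff_iff] at hst
    by_cases hX : X s
    · have hX' := hst.1.1 hX
      simpa [W, hX, hX'] using ⟨hzl_ST.eq_iff s t, hzl_ST.adj_iff s t⟩
    · have hX' := mt hst.1.2 hX
      by_cases hY : Y s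
      · have hY' : Y t := (hst.2.1 ⟨hX, hY⟩).2
        simpa [W, hX, hX', hY, hY'] using ⟨hzj_ST.eq_iff s t, hzj_ST.adj_iff s t⟩
      · have hY' : ¬ Y t := fun h => hY (hst.2.2 ⟨hX', h⟩).2
        simp [W, hX, hX', hY, hY']
  · have hst' : ¬ ((X s ↔ X t) ∧ (¬ X s → (Y s ↔ Y t))) := fun h =>
      hst (Prod.ext (propext h.1) (propext
        ⟨fun k => ⟨mt h.1.2 k.1, (h.2 k.1).1 k.2⟩,
          fun k => ⟨mt h.1.1 k.1, (h.2 (mt h.1.1 k.1)).2 k.2⟩⟩))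
    constructor
    · exact one_lt_edist_of_region (hpq z l hzl.ne) (fun s hs => hs) (fun s _ hs => hs)
        (fun s hs hs' => ⟨hXz s hs, hYl s hs'⟩) hst'
    · refine one_lt_edist_of_region (X := X) (Y := Y) (hpq i j hji.ne') (fun s hs => ?_)
        (fun s hs hs' => ?_) (fun s hs hs' => ?_) hst'
      · simpa [W, hs] using homa z l i l hzl hil s e (by omega) hs
      · simpa [W, hs, hs'] using homb z l z j hzl hzj s f (by omega) hs'
      · simp only [W, hs, hs', if_false]
        exact ⟨lt_of_not_ge fun h => hi_a s ⟨hs, h⟩, lt_of_not_ge fun h => hj_b s ⟨hs', h⟩⟩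

end Far

/-! ### One round of the game, and the induction on rounds -/

section Survival

variable {V : Type u} {κ : Type*} {I : Type*}

theorem forall_or_forall_ne_of_homogeneous {n : ℕ} {Q : Fin n → Fin n → Prop}
    (hrefl : ∀ i, Q i i) (hsymm : ∀ i j, Q i j → Q j i)
    (hom : ∀ i j i' j', i < j → i' < j' → Q i j → Q i' j') :
    (∀ i j, Q i j) ∨ ∀ i j, i ≠ j → ¬ Q i j := by
  by_cases h : ∃ i j, i < j ∧ Q i j
  · obtain ⟨i, j, hij, hQ⟩ := h
    left
    intro i' j'
    rcases lt_trichotomy i' j' with h | rfl | h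
    · exact hom _ _ _ _ hij h hQ
    · exact hrefl _
    · exact hsymm _ _ (hom _ _ _ _ hij h hQ)
  · right
    intro i j hij hQ
    rcases lt_or_gt_of_ne hij with h' | h'
    · exact h ⟨i, j, h', hQ⟩
    · exact h ⟨j, i, h', hsymm _ _ hQ⟩

/-- Any sufficiently long ladder contains a long ladder that survives in a ball of bounded radius
and in all flips of that ball. -/
theorem exists_weakLadder_flip_closedBall [Fintype I] (x y : I) :
    ∃ r : ℕ, ∀ (κ : Type w) [Finite κ] (n : ℕ), ∃ N : ℕ, ∀ {V : Type u} (G : SimpleGraph V)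
      (col : V → κ), WeakLadder G col x y N → ∃ c : V, ∀ A B : Set (closedBall G c r),
        WeakLadder (flip (G.induce (closedBall G c r)) A B) (ballCol G col c r A B) x y n := by
  obtain ⟨m, hm⟩ : ∃ m, Fintype.card I = m := ⟨_, rfl⟩
  obtain ⟨d, hd⟩ : ∃ d, d = 2 * m + 2 := ⟨_, rfl⟩
  obtain ⟨E, hE⟩ : ∃ E, E = d + m * (d + 1) := ⟨_, rfl⟩
  obtain ⟨D, hD⟩ : ∃ D, D = 2 * E + 2 := ⟨_, rfl⟩
  -- `D + D` pays for a detour through a common close point, `m` for the gap inside the ball.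
  refine ⟨D + D + m, fun κ _ n => ?_⟩
  -- The colours record the atomic type, distances to both base points up to `D`, and closeness of
  -- base points, in both orders for `a` against `b`. The length allows `n` inner indices, two
  -- flanking ones and the `2 * m + 4` of the far case.
  obtain ⟨N, hN⟩ := ramsey_pairs ((I → κ) × (I → I → Prop) × (I → I → Prop) ×
    (I → Fin (D + 1) → Prop) × (I → Fin (D + 1) → Prop) × Prop × Prop × Prop × Prop)
    (n + 2 + (2 * m + 4))
  refine ⟨N, fun {V} G col ⟨a', b', T', hT', hno'⟩ => ?_⟩
  obtain ⟨f, hf, hcol⟩ := hN fun i j =>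
    (fun s => col (T' i j s), fun s t => T' i j s = T' i j t,
      fun s t => G.Adj (T' i j s) (T' i j t),
      fun s k => G.edist (a' i) (T' i j s) ≤ (k : ℕ), fun s k => G.edist (b' j) (T' i j s) ≤ (k : ℕ),
      G.edist (a' i) (a' j) ≤ d, G.edist (b' i) (b' j) ≤ d,
      G.edist (a' i) (b' j) ≤ D, G.edist (b' i) (a' j) ≤ D)
  obtain ⟨a, ha⟩ : ∃ a, a = a' ∘ f := ⟨_, rfl⟩
  obtain ⟨b, hb⟩ : ∃ b, b = b' ∘ f := ⟨_, rfl⟩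
  obtain ⟨T, hTdef⟩ : ∃ T, T = fun i j => T' (f i) (f j) := ⟨_, rfl⟩
  have hT : ∀ i j, i < j → T i j x = a i ∧ T i j y = b j := by
    subst ha hb hTdef
    exact fun i j hij => hT' _ _ (hf hij)
  have hno : ∀ i j i' j', i < j → j' ≤ i' → ∀ T' : I → V, T' x = a i' → T' y = b j' →
      ¬ SameType G col (T i j) T' := by
    subst ha hb hTdef
    exact fun i j i' j' h h' => hno' _ _ _ _ (hf h) (hf.monotone h')
  simp only [Prod.mk.injEq] at hcol
  have hST : ∀ i j i' j', i < j → i' < j' → SameType G col (T i j) (T i' j') := by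
    subst hTdef
    intro i j i' j' h h'
    obtain ⟨h₁, h₂, h₃, -⟩ := hcol i j i' j' h h'
    exact ⟨congrFun h₁, fun s t => iff_of_eq (congrFun (congrFun h₂ s) t),
      fun s t => iff_of_eq (congrFun (congrFun h₃ s) t)⟩
  have homa : ∀ i j i' j', i < j → i' < j' → ∀ s, ∀ k ≤ 2 * E + 2,
      G.edist (a i) (T i j s) ≤ (k : ℕ) → G.edist (a i') (T i' j' s) ≤ (k : ℕ) := by
    subst hTdef ha
    intro i j i' j' h h' s k hk
    obtain ⟨-, -, -, h₄, -⟩ := hcol i j i' j' h h'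
    exact (congrFun (congrFun h₄ s) ⟨k, by omega⟩).mp
  have homb : ∀ i j i' j', i < j → i' < j' → ∀ s, ∀ k ≤ 2 * E + 2,
      G.edist (b j) (T i j s) ≤ (k : ℕ) → G.edist (b j') (T i' j' s) ≤ (k : ℕ) := by
    subst hTdef hb
    intro i j i' j' h h' s k hk
    obtain ⟨-, -, -, -, h₅, -⟩ := hcol i j i' j' h h'
    exact (congrFun (congrFun h₅ s) ⟨k, by omega⟩).mp
  have haa := forall_or_forall_ne_of_homogeneous (Q := fun i j => G.edist (a i) (a j) ≤ d)
    (by simp) (fun i j h => SimpleGraph.edist_comm.trans_le h) (by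
      subst ha
      exact fun i j i' j' h h' => (hcol i j i' j' h h').2.2.2.2.2.1.mp)
  have hbb := forall_or_forall_ne_of_homogeneous (Q := fun i j => G.edist (b i) (b j) ≤ d)
    (by simp) (fun i j h => SimpleGraph.edist_comm.trans_le h) (by
      subst hb
      exact fun i j i' j' h h' => (hcol i j i' j' h h').2.2.2.2.2.2.1.mp)
  have hab : ∀ i j i' j', i < j → i' < j' → G.edist (a i) (b j) ≤ D →
      G.edist (a i') (b j') ≤ D := by
    subst ha hb
    exact fun i j i' j' h h' => (hcol i j i' j' h h').2.2.2.2.2.2.2.1.mp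
  have hba : ∀ i j i' j', i < j → i' < j' → G.edist (b i) (a j) ≤ D →
      G.edist (b i') (a j') ≤ D := by
    subst ha hb
    exact fun i j i' j' h h' => (hcol i j i' j' h h').2.2.2.2.2.2.2.2.mp
  clear hcol hT' hno'
  let z : Fin (n + 2 + (2 * m + 4)) := ⟨0, by omega⟩
  let l : Fin (n + 2 + (2 * m + 4)) := ⟨n + 1, by omega⟩
  let g : Fin n → Fin (n + 2 + (2 * m + 4)) := fun i => ⟨i + 1, by omega⟩
  have hg : StrictMono g := fun i j hij => Fin.mk_lt_mk.2 (Nat.succ_lt_succ hij)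
  have hzg : ∀ i, z < g i := fun i => Fin.mk_lt_mk.2 (Nat.succ_pos _)
  have hgl : ∀ i, g i < l := fun i => Fin.mk_lt_mk.2 (Nat.succ_lt_succ i.2)
  have hzl : z < l := Fin.mk_lt_mk.2 (Nat.succ_pos _)
  have hle : ((D : ℕ) : ℕ∞) ≤ ((D + D : ℕ) : ℕ∞) := by exact_mod_cast Nat.le_add_left _ _
  have htri : ∀ u v w : V, G.edist u v ≤ D → G.edist w v ≤ D → G.edist u w ≤ (D + D : ℕ) := by
    intro u v w h h'
    rw [SimpleGraph.edist_comm] at h'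
    exact_mod_cast SimpleGraph.edist_triangle.trans (add_le_add h h')
  have key : ∀ c : V, (∀ i, G.edist c (a (g i)) ≤ (D + D : ℕ)) →
      (∀ i, G.edist c (b (g i)) ≤ (D + D : ℕ)) → ∃ c : V, ∀ A B : Set (closedBall G c (D + D + m)),
        WeakLadder (flip (G.induce (closedBall G c (D + D + m))) A B)
          (ballCol G col c (D + D + m) A B) x y n := fun c h h' =>
    ⟨c, weakLadder_flip_closedBall (T := fun i j => T (g i) (g j)) (fun i j hij => hT _ _ (hg hij))
      (fun i j i' j' h h' => hno _ _ _ _ (hg h) (hg.monotone h')) (by omega) h h'⟩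
  -- By homogeneity one close pair makes all pairs in that order close, so the first point `a z` (or
  -- `b z` for the other order) can serve as centre.
  by_cases h₁ : G.edist (a z) (b l) ≤ D
  · exact key (a z) (fun i => htri _ _ _ h₁ (hab _ _ _ _ hzl (hgl i) h₁))
      fun i => (hab _ _ _ _ hzl (hzg i) h₁).trans hle
  by_cases h₂ : G.edist (b z) (a l) ≤ D
  · exact key (b z) (fun i => (hba _ _ _ _ hzl (hzg i) h₂).trans hle)
      fun i => htri _ _ _ h₂ (hba _ _ _ _ hzl (hgl i) h₂)
  refine (not_forall_far hT hno hm hd hE (by omega) hST homa homb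
    (haa.imp_right fun h i j hij => not_le.1 (h i j hij))
    (hbb.imp_right fun h i j hij => not_le.1 (h i j hij)) fun i j hij => ?_).elim
  rw [← hD]
  refine lt_of_not_ge fun h => ?_
  rcases lt_or_gt_of_ne hij with h' | h'
  · exact h₁ (hab _ _ _ _ h' hzl h)
  · exact h₂ (hba _ _ _ _ h' hzl (SimpleGraph.edist_comm.trans_le h))

/-- The palette is quantified after `r`, so the induction on rounds can enlarge it at a fixed
radius. -/
theorem exists_forall_connectorSurvives [Fintype I] (x y : I) :
    ∃ r : ℕ, ∀ (ℓ : ℕ) (κ : Type w) [Finite κ], ∃ N : ℕ, ∀ {V : Type u} (G : SimpleGraph V)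
      (col : V → κ), WeakLadder G col x y N → ConnectorSurvives r ℓ G := by
  obtain ⟨r, hr⟩ := exists_weakLadder_flip_closedBall.{u, w} x y
  refine ⟨r, fun ℓ => ?_⟩
  induction ℓ with
  | zero => exact fun κ _ => ⟨2, fun G col h => h.nontrivial le_rfl⟩
  | succ ℓ ih =>
    intro κ _
    obtain ⟨n, hn⟩ := ih (κ × (Fin (r + 1) → Prop) × Prop × Prop)
    obtain ⟨N, hN⟩ := hr κ n
    refine ⟨max 2 N, fun G col h => ⟨h.nontrivial (le_max_left _ _), ?_⟩⟩
    obtain ⟨c, hc⟩ := hN G col (h.mono (le_max_right _ _))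
    exact ⟨c, fun A B => hn _ _ (hc A B)⟩

end Survival

/-! ### From existential formulas to atomic types -/

section Formulas

/-- The colouring of the vertices by the predicates in `S` that hold at them. -/
def predCol {P : Type w} {V : Type u} (U : P → Set V) (S : Finset P) : V → S → Prop :=
  fun v p => v ∈ U p

theorem SameType.predCol_mono {P : Type w} {V : Type u} {I : Type*} {G : SimpleGraph V}
    {U : P → Set V} {S S' : Finset P} (hS : S ⊆ S') {T T' : I → V}
    (h : SameType G (predCol U S') T T') : SameType G (predCol U S) T T' :=
  h.map_col fun (k : S' → Prop) (p : S) => k ⟨p, hS p.2⟩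

theorem exists_term_eq_var {P : Type w} {α : Type*} (t : (liftLanguage P).Term α) :
    ∃ s, t = FirstOrder.Language.Term.var s := by
  cases t with
  | var s => exact ⟨s, rfl⟩
  | func f _ => exact f.elim

/-- The truth of a quantifier-free formula depends only on the atomic type of the arguments over
finitely many predicates. -/
theorem exists_realize_iff_of_isQF {P : Type w} {α : Type} {n : ℕ}
    {φ : (liftLanguage P).BoundedFormula α n} (hφ : φ.IsQF) :
    ∃ S : Finset P, ∀ {V : Type u} (G : SimpleGraph V) (U : P → Set V) (v v' : α → V)
      (xs xs' : Fin n → V), SameType G (predCol U S) (Sum.elim v xs) (Sum.elim v' xs') →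
        letI := monadicLift G U
        (φ.Realize v xs ↔ φ.Realize v' xs') := by
  classical
  induction hφ with
  | falsum => exact ⟨∅, fun _ _ _ _ _ _ _ => Iff.rfl⟩
  | of_isAtomic h =>
    cases h with
    | equal t₁ t₂ =>
      obtain ⟨s₁, rfl⟩ := exists_term_eq_var t₁
      obtain ⟨s₂, rfl⟩ := exists_term_eq_var t₂
      refine ⟨∅, fun G U v v' xs xs' h => ?_⟩
      let := monadicLift G U
      simpa using h.eq_iff s₁ s₂
    | rel R ts =>
      choose s hs using fun i => exists_term_eq_var (ts i)
      obtain rfl : ts = fun i => FirstOrder.Language.Term.var (s i) := funext hs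
      cases R with
      | adj =>
        exact ⟨∅, fun G U v v' xs xs' h => h.adj_iff (s 0) (s 1)⟩
      | pred p =>
        exact ⟨{p}, fun G U v v' xs xs' h =>
          iff_of_eq (congrFun (h.col_eq (s 0)) ⟨p, Finset.mem_singleton_self p⟩)⟩
  | imp _ _ ih₁ ih₂ =>
    obtain ⟨S₁, h₁⟩ := ih₁
    obtain ⟨S₂, h₂⟩ := ih₂
    refine ⟨S₁ ∪ S₂, fun G U v v' xs xs' h => ?_⟩
    exact imp_congr (h₁ G U v v' xs xs' (h.predCol_mono Finset.subset_union_left))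
      (h₂ G U v v' xs xs' (h.predCol_mono Finset.subset_union_right))

/-- If an existential formula holds, then boundedly many witnesses certify it, in the sense that
it holds for all arguments that can be extended to a tuple of the same atomic type. -/
theorem IsExistential.exists_witnesses {P : Type w} {α : Type} [Nonempty α] {n : ℕ}
    {φ : (liftLanguage P).BoundedFormula α n} (hφ : IsExistential φ) :
    ∃ (J : Type) (_ : Fintype J) (S : Finset P), ∀ {V : Type u} (G : SimpleGraph V) (U : P → Set V)
      (v : α → V) (xs : Fin n → V), letI := monadicLift G U
      φ.Realize v xs → ∃ w : J → V, ∀ (v' : α → V) (xs' : Fin n → V) (w' : J → V),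
        SameType G (predCol U S) (Sum.elim (Sum.elim v xs) w) (Sum.elim (Sum.elim v' xs') w') →
          φ.Realize v' xs' := by
  classical
  induction hφ with
  | of_isQF h =>
    obtain ⟨S, hS⟩ := exists_realize_iff_of_isQF h
    refine ⟨Empty, inferInstance, S, fun G U v xs h => ⟨Empty.elim, fun v' xs' w' h' => ?_⟩⟩
    exact (hS G U v v' xs xs' (h'.comp Sum.inl)).1 h
  | inf _ _ ih₁ ih₂ =>
    obtain ⟨J₁, _, S₁, h₁⟩ := ih₁
    obtain ⟨J₂, _, S₂, h₂⟩ := ih₂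
    refine ⟨J₁ ⊕ J₂, inferInstance, S₁ ∪ S₂, fun G U v xs h => ?_⟩
    let := monadicLift G U
    rw [FirstOrder.Language.BoundedFormula.realize_inf] at h
    obtain ⟨w₁, hw₁⟩ := h₁ G U v xs h.1
    obtain ⟨w₂, hw₂⟩ := h₂ G U v xs h.2
    refine ⟨Sum.elim w₁ w₂, fun v' xs' w' h' => ?_⟩
    rw [FirstOrder.Language.BoundedFormula.realize_inf]
    refine ⟨hw₁ v' xs' (w' ∘ Sum.inl) ?_, hw₂ v' xs' (w' ∘ Sum.inr) ?_⟩
    · have := (h'.predCol_mono Finset.subset_union_left).comp (Sum.map id Sum.inl)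
      simpa only [Sum.elim_comp_map, Function.comp_id, Sum.elim_comp_inl,
        Sum.elim_comp_inr] using this
    · have := (h'.predCol_mono Finset.subset_union_right).comp (Sum.map id Sum.inr)
      simpa only [Sum.elim_comp_map, Function.comp_id, Sum.elim_comp_inl,
        Sum.elim_comp_inr] using this
  | sup _ _ ih₁ ih₂ =>
    obtain ⟨J₁, _, S₁, h₁⟩ := ih₁
    obtain ⟨J₂, _, S₂, h₂⟩ := ih₂
    refine ⟨J₁ ⊕ J₂, inferInstance, S₁ ∪ S₂, fun G U v xs h => ?_⟩
    let := monadicLift G U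
    -- Filler for the witnesses of the disjunct not used; `α` being nonempty supplies a vertex.
    let v₀ := v (Classical.arbitrary α)
    rw [FirstOrder.Language.BoundedFormula.realize_sup] at h
    rcases h with h | h
    · obtain ⟨w₁, hw₁⟩ := h₁ G U v xs h
      refine ⟨Sum.elim w₁ fun _ => v₀, fun v' xs' w' h' => ?_⟩
      rw [FirstOrder.Language.BoundedFormula.realize_sup]
      refine Or.inl (hw₁ v' xs' (w' ∘ Sum.inl) ?_)
      have := (h'.predCol_mono Finset.subset_union_left).comp (Sum.map id Sum.inl)
      simpa only [Sum.elim_comp_map, Function.comp_id, Sum.elim_comp_inl,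
        Sum.elim_comp_inr] using this
    · obtain ⟨w₂, hw₂⟩ := h₂ G U v xs h
      refine ⟨Sum.elim (fun _ => v₀) w₂, fun v' xs' w' h' => ?_⟩
      rw [FirstOrder.Language.BoundedFormula.realize_sup]
      refine Or.inr (hw₂ v' xs' (w' ∘ Sum.inr) ?_)
      have := (h'.predCol_mono Finset.subset_union_right).comp (Sum.map id Sum.inr)
      simpa only [Sum.elim_comp_map, Function.comp_id, Sum.elim_comp_inl,
        Sum.elim_comp_inr] using this
  | @ex n _ _ ih =>
    obtain ⟨J, _, S, hS⟩ := ih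
    refine ⟨Unit ⊕ J, inferInstance, S, fun G U v xs h => ?_⟩
    let := monadicLift G U
    rw [FirstOrder.Language.BoundedFormula.realize_ex] at h
    obtain ⟨e, he⟩ := h
    obtain ⟨w, hw⟩ := hS G U v _ he
    refine ⟨Sum.elim (fun _ => e) w, fun v' xs' w' h' => ?_⟩
    rw [FirstOrder.Language.BoundedFormula.realize_ex]
    refine ⟨w' (Sum.inl ()), hw v' _ (w' ∘ Sum.inr) ?_⟩
    -- The quantified vertex is the extra `Unit` witness; `g` reindexes it as the last bound
    -- variable.
    let g : (α ⊕ Fin (n + 1)) ⊕ J → (α ⊕ Fin n) ⊕ (Unit ⊕ J) :=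
      Sum.elim (Sum.elim (fun i => Sum.inl (Sum.inl i))
        (Fin.snoc (α := fun _ => (α ⊕ Fin n) ⊕ (Unit ⊕ J)) (fun i => Sum.inl (Sum.inr i))
          (Sum.inr (Sum.inl ())))) fun i => Sum.inr (Sum.inr i)
    have hg : ∀ {V : Type _} (v : α → V) (xs : Fin n → V) (w : Unit ⊕ J → V),
        Sum.elim (Sum.elim v xs) w ∘ g =
          Sum.elim (Sum.elim v (Fin.snoc xs (w (Sum.inl ())))) (w ∘ Sum.inr) := by
      intro V v xs w
      funext s
      rcases s with (s | s) | s
      · rfl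
      · refine Fin.lastCases ?_ (fun i => ?_) s <;> simp [g]
      · rfl
    have := h'.comp g
    rw [hg, hg] at this
    exact this

end Formulas

end FlipperGame

/-! ### From the ladder of the formula to a weak ladder -/

theorem lemma3p2
    (C : Set (Σ V : Type u, SimpleGraph V))
    (P : Type w) (φ : (FlipperGame.liftLanguage P).Formula (Fin 2))
    (hφ : FlipperGame.IsExistential φ)
    (hladder : ∀ k : ℕ, ∃ G ∈ C, ∃ U : P → Set G.1, ∃ n : ℕ, k ≤ n ∧
      FlipperGame.DefinesLadder φ G.2 U n) :
    ∃ r : ℕ, ∀ ℓ : ℕ, ∃ G ∈ C, FlipperGame.ConnectorSurvives r ℓ G.2 := by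
  obtain ⟨J, _, S, hS⟩ := hφ.exists_witnesses
  let I := (Fin 2 ⊕ Fin 0) ⊕ J
  let x : I := Sum.inl (Sum.inl 0)
  let y : I := Sum.inl (Sum.inl 1)
  obtain ⟨r, hr⟩ := FlipperGame.exists_forall_connectorSurvives x y
  refine ⟨r, fun ℓ => ?_⟩
  obtain ⟨N, hN⟩ := hr ℓ (S → Prop)
  obtain ⟨G, hG, U, n, hn, a, b, hab⟩ := hladder N
  refine ⟨G, hG, hN G.2 (FlipperGame.predCol U S) (FlipperGame.WeakLadder.mono ?_ hn)⟩
  have hwit : ∀ i j : Fin n, ∃ w : J → G.1, i < j → ∀ (v' : Fin 2 → G.1) (xs' : Fin 0 → G.1)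
      (w' : J → G.1), FlipperGame.SameType G.2 (FlipperGame.predCol U S)
        (Sum.elim (Sum.elim ![a i, b j] default) w) (Sum.elim (Sum.elim v' xs') w') →
        letI := FlipperGame.monadicLift G.2 U
        FirstOrder.Language.BoundedFormula.Realize φ v' xs' := by
    intro i j
    by_cases hij : i < j
    · obtain ⟨w, hw⟩ := hS G.2 U _ _ ((hab i j).2 hij)
      exact ⟨w, fun _ => hw⟩
    · exact ⟨fun _ => a i, fun h => absurd h hij⟩
  choose w hw using hwit
  refine ⟨a, b, fun i j => Sum.elim (Sum.elim ![a i, b j] default) (w i j),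
    fun i j _ => ⟨rfl, rfl⟩, fun i j i' j' hij hji T' hx hy hST => ?_⟩
  refine absurd ((hab i' j').1 ?_) (not_lt.2 hji)
  refine hw i j hij _ _ (T' ∘ Sum.inr) ?_
  convert hST using 1
  funext s
  rcases s with (s | s) | s
  · fin_cases s
    · exact hx.symm
    · exact hy.symm
  · exact s.elim0
  · rfl
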